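/- Let $\mathcal{G}$ be a weighted directed graph with vertex set $\mathcal{V}=\{1,\dots,n\}$ and nonnegative weighted adjacency matrix $W\in\mathbb{R}^{n\times n}$, where $W_{ij}>0$ exactly when there is an arc from $i$ to $j$. Assume that $\mathcal{G}$ is strongly connected. Put $d_i=\sum_j W_{ij}$ and $d_{\mathcal{G}}=\sum_i d_i$. The random walk on $\mathcal{G}$ is the Markov chain with transition probabilities $P_{ij}=W_{ij}/d_i$, and $\pi$ is its stationary distribution, that is, the unique probability vector with $\pi^\top P=\pi^\top$. Let $i\in\mathcal{V}$, and let $\mathcal{X}\subset\mathcal{V}$ be a nonempty set with $i\notin\mathcal{X}$. Let $P_{\mathrm{es}}(i,\mathcal{X})$ be the probability that the random walk started at $i$ reaches some vertex of $\mathcal{X}$ before it returns to $i$, and let $$\Omega(i,\mathcal{X})=\frac{1}{d_{\mathcal{G}}\,\pi_i\,P_{\mathrm{es}}(i,\mathcal{X})}$$ be the resistance distance between $i$ and $\mathcal{X}$. Let $C(i,\mathcal{X})$ be the commute time, that is, the expected number of steps that the random walk started at $i$ needs to visit first some vertex of $\mathcal{X}$ and then return to $i$. Then $d_{\mathcal{G}}\,\pi_i\,P_{\mathrm{es}}(i,\mathcal{X})\neq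 0$, $C(i,\mathcal{X})$ is finite, and $$\Omega(i,\mathcal{X})=\frac{1}{d_{\mathcal{G}}}\,C(i,\mathcal{X}).$$ -/

import Mathlib

open MeasureTheory ProbabilityTheory
open scoped ENNReal Matrix

/-- A weighted directed graph on the vertex set `Fin n`, given by its nonnegative weighted
adjacency matrix; there is an arc from `i` to `j` exactly when `0 < weight i j`. -/
structure WeightedDigraph (n : ℕ) where
  weight : Matrix (Fin n) (Fin n) ℝ
  weight_nonneg : ∀ i j, 0 ≤ weight i j

namespace WeightedDigraph

variable {n : ℕ} (G : WeightedDigraph n)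

/-- There is an arc pointing from `i` to `j`. -/
def Arc (i j : Fin n) : Prop := 0 < G.weight i j

/-- Every vertex is reachable from every other vertex along arcs. -/
def StronglyConnected : Prop := ∀ i j, Relation.ReflTransGen G.Arc i j

/-- The out-degree `d i`, the sum of the weights of the arcs leaving `i`. -/
noncomputable def degree (i : Fin n) : ℝ := ∑ j, G.weight i j

/-- The volume `d_G` of the digraph, the sum of all degrees. -/
noncomputable def volume : ℝ := ∑ i, G.degree i

/-- The transition matrix `P = D⁻¹ W` of the random walk, where `D` is the diagonal degree
matrix. -/
noncomputable def transition : Matrix (Fin n) (Fin n) ℝ :=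
  Matrix.of fun i j => G.weight i j / G.degree i

theorem sum_ofReal_transition {i : Fin n} (h : 0 < G.degree i) :
    ∑ j, ENNReal.ofReal (G.transition i j) = 1 := by
  rw [← ENNReal.ofReal_sum_of_nonneg]
  · simp only [transition, Matrix.of_apply, ← Finset.sum_div]
    rw [show ∑ j, G.weight i j = G.degree i from rfl, div_self h.ne', ENNReal.ofReal_one]
  · intro j _
    exact div_nonneg (G.weight_nonneg i j) h.le

open Classical in
/-- The distribution of the next vertex of the random walk standing at `i`: the `i`-th row of
the transition matrix. At a vertex without outgoing arcs (there is none in a strongly connected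
digraph with at least two vertices) the walk is declared to stay where it is. -/
noncomputable def stepPMF (i : Fin n) : PMF (Fin n) :=
  if h : 0 < G.degree i then
    PMF.ofFintype (fun j => ENNReal.ofReal (G.transition i j)) (G.sum_ofReal_transition h)
  else PMF.pure i

/-- The one-step Markov kernel of the random walk. -/
noncomputable def stepKernel : Kernel (Fin n) (Fin n) :=
  Kernel.ofFunOfCountable fun i => (G.stepPMF i).toMeasure

instance : IsMarkovKernel G.stepKernel :=
  ⟨fun i => inferInstanceAs (IsProbabilityMeasure (G.stepPMF i).toMeasure)⟩

/-- The distribution of the vertex at time `t + 1` given the vertices at times `0, …, t`: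
it depends only on the vertex at time `t`. -/
noncomputable def historyKernel (t : ℕ) :
    Kernel ((s : Finset.Iic t) → (fun _ : ℕ => Fin n) s) (Fin n) :=
  G.stepKernel.comap (fun h => h ⟨t, Finset.mem_Iic.2 le_rfl⟩) (measurable_pi_apply _)

instance (t : ℕ) : IsMarkovKernel (G.historyKernel t) := by
  unfold historyKernel; infer_instance

/-- The law, on the space of trajectories `ℕ → Fin n`, of the random walk started at `i`. -/
noncomputable def walkLaw (i : Fin n) : Measure (ℕ → Fin n) :=
  Kernel.trajMeasure (X := fun _ => Fin n) (Measure.dirac i) G.historyKernel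

/-- `π` is a stationary distribution of the random walk: a probability vector with `πᵀ P = πᵀ`. -/
def IsStationary (π : Fin n → ℝ) : Prop :=
  π ∈ stdSimplex ℝ (Fin n) ∧ π ᵥ* G.transition = π

/-- The stationary distribution of the random walk. On a strongly connected digraph with at least
two vertices there is exactly one. -/
noncomputable def stationary : Fin n → ℝ := Classical.epsilon G.IsStationary

/-- The escape probability: the probability that the random walk started at `i` reaches some
vertex of `X` before it returns to `i`. -/
noncomputable def escapeProb (i : Fin n) (X : Set (Fin n)) : ℝ :=
  (G.walkLaw i).real {ω | ∃ t, ω t ∈ X ∧ ∀ s, 1 ≤ s → s ≤ t → ω s ≠ i}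

/-- The resistance distance between a vertex `i` and a nonempty set `X` of vertices with
`i ∉ X`. -/
noncomputable def resistance (i : Fin n) (X : Set (Fin n)) : ℝ :=
  1 / (G.volume * G.stationary i * G.escapeProb i X)

/-- The first time at which a trajectory is at `i` after a visit to some vertex of `X`
(`∞` if there is no such time). -/
noncomputable def returnTimeVia (i : Fin n) (X : Set (Fin n)) (ω : ℕ → Fin n) : ℝ≥0∞ :=
  ⨅ (t : ℕ) (_ : ω t = i ∧ ∃ s ≤ t, ω s ∈ X), (t : ℝ≥0∞)

/-- The commute time between `i` and `X`: the expected number of steps that the random walk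
started at `i` needs to visit first some vertex of `X` and then return to `i`. -/
noncomputable def commuteTime (i : Fin n) (X : Set (Fin n)) : ℝ≥0∞ :=
  ∫⁻ ω, returnTimeVia i X ω ∂G.walkLaw i

end WeightedDigraph

/-! For the walk started at `j`, let `a j` be the mean time to visit `X` and then `i`, `b j` the
mean hitting time of `i`, and `p j` the probability of meeting `X` before `i`. If `X` comes first,
the visit to `X` costs nothing beyond reaching `i`; otherwise the walk reaches `i` and the whole
commute remains. Hence `a j - b j = (1 - p j) * a i`. Averaging over the first step from `i` turns
this into `escapeProb * a i = 1 + ∑ k, P i k * b k`, the mean return time, which Kac's formula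
identifies as `1 / π i`. So `π i * escapeProb * a i = 1`, and the theorem follows on inverting.

No strong Markov property is needed: `lintegral_walkLaw` gives linear equations for `a`, `b`, `p`,
and the maximum principle `subharmonic_nonpos` forces the identity. Finiteness of the expectations
comes separately from `lintegral_walkLaw_ne_top`. -/

/-! ### Sequences, cylinders and uniqueness of measures -/

/-- The sequence with first term `a` followed by the terms of `ω`. -/
def seqCons {α : Type*} (a : α) (ω : ℕ → α) : ℕ → α
  | 0 => a
  | t + 1 => ω t

@[simp] theorem seqCons_zero {α : Type*} (a : α) (ω : ℕ → α) : seqCons a ω 0 = a := rfl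

@[simp] theorem seqCons_succ {α : Type*} (a : α) (ω : ℕ → α) (t : ℕ) :
    seqCons a ω (t + 1) = ω t := rfl

theorem measurable_seqCons {α : Type*} [MeasurableSpace α] (a : α) :
    Measurable (seqCons a : (ℕ → α) → ℕ → α) := by
  refine measurable_pi_lambda _ fun t => ?_
  cases t with
  | zero => exact measurable_const
  | succ t => exact measurable_pi_apply t

/-- The cylinder of the sequences that agree with `x` up to time `t`. -/
theorem initial_segment_eq_preimage {α : Type*} (x : ℕ → α) (t : ℕ) :
    {ω : ℕ → α | ∀ s ≤ t, ω s = x s} =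
      Preorder.frestrictLe (π := fun _ => α) t ⁻¹'
        {Preorder.frestrictLe (π := fun _ => α) t x} := by
  ext ω
  simp only [Set.mem_preimage, Set.mem_singleton_iff, Set.mem_ofPred_eq, funext_iff,
    Subtype.forall, Finset.mem_Iic, Preorder.frestrictLe_apply]

theorem measurableSet_initial_segment {α : Type*} [MeasurableSpace α] [MeasurableSingletonClass α]
    (x : ℕ → α) (t : ℕ) : MeasurableSet {ω : ℕ → α | ∀ s ≤ t, ω s = x s} := by
  rw [initial_segment_eq_preimage]
  exact (Preorder.measurable_frestrictLe (X := fun _ => α) t) (measurableSet_singleton _)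

/-- Two finite measures on the sequences in a countable discrete space agree if they give the same
mass to every cylinder fixing the first terms of a sequence. -/
theorem measure_ext_of_initial_segments {α : Type*} [Countable α] [MeasurableSpace α]
    [MeasurableSingletonClass α] [Nonempty α] {μ ν : Measure (ℕ → α)} [IsFiniteMeasure μ] (a : ℕ)
    (h : ∀ t ≥ a, ∀ x : ℕ → α, μ {ω | ∀ s ≤ t, ω s = x s} = ν {ω | ∀ s ≤ t, ω s = x s}) :
    μ = ν := by
  have key : ∀ t ≥ a, μ.map (Preorder.frestrictLe t) = ν.map (Preorder.frestrictLe t) := by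
    intro t ht
    refine Measure.ext_of_singleton fun y => ?_
    obtain ⟨x, rfl⟩ : ∃ x : ℕ → α, Preorder.frestrictLe (π := fun _ => α) t x = y :=
      ⟨fun s => if hs : s ≤ t then y ⟨s, Finset.mem_Iic.2 hs⟩ else Classical.arbitrary α, by
        funext ⟨s, hs⟩
        simp [Finset.mem_Iic.1 hs]⟩
    rw [Measure.map_apply (by fun_prop) (measurableSet_singleton _),
      Measure.map_apply (by fun_prop) (measurableSet_singleton _), ← initial_segment_eq_preimage]
    exact h t ht _
  -- Both measures are projective limits of the marginals of `μ`; for `ν` the initial intervals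
  -- suffice.
  have hμ : IsProjectiveLimit μ fun I : Finset ℕ => μ.map I.restrict := fun I => rfl
  have hproj : IsProjectiveMeasureFamily (fun I : Finset ℕ => μ.map I.restrict) := by
    intro I J hJI
    simp only
    rw [Measure.map_map (by fun_prop) (by fun_prop)]
    rfl
  have hν : IsProjectiveLimit ν fun I : Finset ℕ => μ.map I.restrict :=
    (isProjectiveLimit_nat_iff' hproj ν a).2 fun t ht => (key t ht).symm
  exact hμ.unique hν

/-! ### The walk law and its first-step decomposition -/

namespace WeightedDigraph

variable {n : ℕ} (G : WeightedDigraph n)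

instance (i : Fin n) : IsProbabilityMeasure (G.walkLaw i) := by
  unfold walkLaw; infer_instance

theorem walkLaw_initial_segment (i : Fin n) (x : ℕ → Fin n) (t : ℕ) :
    G.walkLaw i {ω | ∀ s ≤ t, ω s = x s} =
      (if x 0 = i then 1 else 0) * ∏ s ∈ Finset.range t, G.stepPMF (x s) (x (s + 1)) := by
  induction t with
  | zero =>
    rw [initial_segment_eq_preimage, ← Measure.map_apply (by fun_prop) (measurableSet_singleton _),
      walkLaw, Kernel.trajMeasure, Measure.map_comp _ _ (by fun_prop), Kernel.traj_map_frestrictLe,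
      Kernel.partialTraj_self, Measure.id_comp, Measure.map_dirac,
      Measure.dirac_apply' _ (measurableSet_singleton _)]
    simp only [Set.indicator_apply, Set.mem_singleton_iff, funext_iff, Pi.one_apply,
      Finset.range_zero, Finset.prod_empty, mul_one]
    congr 1
    simp only [eq_iff_iff]
    constructor
    · intro h
      exact (h ⟨0, by simp⟩).symm
    · rintro rfl ⟨s, hs⟩
      obtain rfl : s = 0 := by simpa using hs
      rfl
  | succ t ih =>
    -- As a rectangle of past and next vertex, the cylinder can be measured by the composition
    -- product with `historyKernel`.
    have h1 : {ω : ℕ → Fin n | ∀ s ≤ t + 1, ω s = x s} =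
        (fun ω => (Preorder.frestrictLe (π := fun _ => Fin n) t ω, ω (t + 1))) ⁻¹'
          ({Preorder.frestrictLe (π := fun _ => Fin n) t x} ×ˢ {x (t + 1)}) := by
      ext ω
      have := Set.ext_iff.1 (initial_segment_eq_preimage x t) ω
      simp only [Set.mem_preimage, Set.mem_singleton_iff, Set.mem_ofPred_eq, Set.mem_prod]
        at this ⊢
      rw [← this]
      simp only [Nat.le_succ_iff, or_imp, forall_and, forall_eq]
    have h2 := Kernel.map_frestrictLe_trajMeasure_compProd_eq_map_trajMeasure
      (X := fun _ => Fin n) (μ₀ := Measure.dirac i) (κ := G.historyKernel) (a := t)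
    rw [h1, ← Measure.map_apply (by fun_prop)
        ((measurableSet_singleton _).prod (measurableSet_singleton _)), walkLaw, ← h2,
      Measure.compProd_apply_prod (measurableSet_singleton _) (measurableSet_singleton _),
      Finset.prod_range_succ, ← mul_assoc, ← ih, lintegral_singleton,
      Measure.map_apply (by fun_prop) (measurableSet_singleton _),
      ← initial_segment_eq_preimage, mul_comm]
    congr 1
    change (G.stepPMF (x t)).toMeasure {x (t + 1)} = _
    rw [PMF.toMeasure_apply_singleton _ _ (measurableSet_singleton _)]

theorem walkLaw_eq_sum (i : Fin n) :
    G.walkLaw i = ∑ j, G.stepPMF i j • (G.walkLaw j).map (seqCons i) := by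
  have : Nonempty (Fin n) := ⟨i⟩
  -- Cylinders of length at least `1` contain a first step to split off.
  refine measure_ext_of_initial_segments 1 fun t ht x => ?_
  obtain ⟨t, rfl⟩ := Nat.exists_eq_add_of_le' ht
  have hm := measurableSet_initial_segment x (t + 1)
  have hpre : seqCons i ⁻¹' {ω : ℕ → Fin n | ∀ s ≤ t + 1, ω s = x s} =
      {ω | x 0 = i ∧ ∀ s ≤ t, ω s = x (s + 1)} := by
    ext ω
    simp only [Set.mem_preimage, Set.mem_ofPred_eq]
    constructor
    · intro h
      exact ⟨(h 0 (by omega)).symm, fun s hs => h (s + 1) (by omega)⟩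
    · rintro ⟨h0, h⟩ (_ | s) hs
      · exact h0.symm
      · exact h s (by omega)
  simp only [Measure.coe_finsetSum, Finset.sum_apply, Measure.smul_apply, smul_eq_mul,
    Measure.map_apply (measurable_seqCons i) hm, hpre]
  rw [walkLaw_initial_segment]
  by_cases h0 : x 0 = i
  · simp only [h0, true_and, if_true, one_mul]
    simp_rw [G.walkLaw_initial_segment _ (fun s => x (s + 1))]
    rw [Finset.prod_range_succ']
    simp [h0, mul_comm]
  · simp [h0]

theorem lintegral_walkLaw (i : Fin n) {f : (ℕ → Fin n) → ℝ≥0∞} (hf : Measurable f) :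
    ∫⁻ ω, f ω ∂G.walkLaw i =
      ∑ j, G.stepPMF i j * ∫⁻ ω, f (seqCons i ω) ∂G.walkLaw j := by
  conv_lhs => rw [walkLaw_eq_sum]
  rw [lintegral_finsetSum_measure]
  simp only [lintegral_smul_measure, lintegral_map hf (measurable_seqCons i), smul_eq_mul]

end WeightedDigraph

/-! ### Irreducible stochastic matrices -/

section Stochastic

variable {ι : Type*} [Fintype ι] {P : Matrix ι ι ℝ}

/-- The maximum principle: a function that is subharmonic for an irreducible stochastic matrix
off a nonempty set where it is nonpositive is nonpositive everywhere. -/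
theorem subharmonic_nonpos (hP : ∀ i j, 0 ≤ P i j) (hsum : ∀ i, ∑ j, P i j = 1)
    (hirr : ∀ i j, Relation.ReflTransGen (fun k l => 0 < P k l) i j) {A : Set ι}
    (hA : A.Nonempty) {x : ι → ℝ} (hxA : ∀ j ∈ A, x j ≤ 0)
    (hx : ∀ j ∉ A, x j ≤ ∑ k, P j k * x k) (j : ι) : x j ≤ 0 := by
  obtain ⟨a, ha⟩ := hA
  obtain ⟨m, -, hm⟩ := Finset.exists_max_image Finset.univ x ⟨a, Finset.mem_univ a⟩
  replace hm : ∀ k, x k ≤ x m := fun k => hm k (Finset.mem_univ k)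
  refine (hm j).trans ?_
  -- The maximum spreads along a path from `m` to `a` until it meets `A`: off `A`, a smaller value
  -- at a successor would pull the average below the maximum.
  suffices H : ∀ k, Relation.ReflTransGen (fun k l => 0 < P k l) k a → x k = x m → x m ≤ 0 from
    H m (hirr m a) rfl
  intro k hk
  induction hk using Relation.ReflTransGen.head_induction_on with
  | refl => exact fun h => h ▸ hxA a ha
  | @head k l hkl _ ih =>
    intro h
    by_cases hkA : k ∈ A
    · exact h ▸ hxA k hkA
    · refine ih (le_antisymm (hm l) ?_)
      by_contra! hlt
      have : ∑ l, P k l * x l < ∑ l, P k l * x m :=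
        Finset.sum_lt_sum (fun l _ => mul_le_mul_of_nonneg_left (hm l) (hP k l))
          ⟨l, Finset.mem_univ l, mul_lt_mul_of_pos_left hlt hkl⟩
      rw [← Finset.sum_mul, hsum, one_mul] at this
      linarith [hx k hkA]

/-- The expected-cost equations of an irreducible stochastic matrix, with nonnegative boundary
values `g` and running cost `1`, have a nonnegative solution. -/
theorem exists_nonneg_solution (hP : ∀ i j, 0 ≤ P i j) (hsum : ∀ i, ∑ j, P i j = 1)
    (hirr : ∀ i j, Relation.ReflTransGen (fun k l => 0 < P k l) i j) {A : Set ι}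
    (hA : A.Nonempty) {g : ι → ℝ} (hg : ∀ j, 0 ≤ g j) :
    ∃ x : ι → ℝ, (∀ j, 0 ≤ x j) ∧ (∀ j ∈ A, x j = g j) ∧
      ∀ j ∉ A, x j = 1 + ∑ k, P j k * x k := by
  classical
  -- The system is square, so uniqueness, which the maximum principle supplies, gives existence.
  let L : (ι → ℝ) →ₗ[ℝ] (ι → ℝ) :=
    { toFun := fun x j => if j ∈ A then x j else x j - ∑ k, P j k * x k
      map_add' := fun x y => by
        funext j
        by_cases h : j ∈ A
        · simp [h]
        · simp only [h, if_false, Pi.add_apply, mul_add, Finset.sum_add_distrib]; ring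
      map_smul' := fun c x => by
        funext j
        by_cases h : j ∈ A
        · simp [h]
        · simp only [h, if_false, Pi.smul_apply, smul_eq_mul, RingHom.id_apply, mul_sub,
            Finset.mul_sum, mul_left_comm] }
  have hL : ∀ x j, L x j = if j ∈ A then x j else x j - ∑ k, P j k * x k := fun _ _ => rfl
  have hker : ∀ x, L x = 0 → ∀ j, x j ≤ 0 := by
    intro x hx
    refine subharmonic_nonpos hP hsum hirr hA (fun j hj => ?_) (fun j hj => ?_)
    · have := congrFun hx j
      simp only [hL, hj, if_true, Pi.zero_apply] at this
      exact this.le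
    · have := congrFun hx j
      simp only [hL, hj, if_false, Pi.zero_apply] at this
      linarith
  have hinj : Function.Injective L := by
    rw [injective_iff_map_eq_zero]
    intro x hx
    funext j
    refine le_antisymm (hker x hx j) ?_
    have := hker (-x) (by rw [map_neg, hx, neg_zero]) j
    simpa using this
  obtain ⟨x, hx⟩ := LinearMap.injective_iff_surjective.1 hinj fun j => if j ∈ A then g j else 1
  have hxA : ∀ j ∈ A, x j = g j := fun j hj => by simpa [hL, hj] using congrFun hx j
  have hxA' : ∀ j ∉ A, x j = 1 + ∑ k, P j k * x k := fun j hj => by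
    have := congrFun hx j
    simp only [hL, hj, if_false] at this
    linarith
  refine ⟨x, fun j => ?_, hxA, hxA'⟩
  have := subharmonic_nonpos hP hsum hirr hA (x := -x) (fun j hj => ?_) (fun j hj => ?_) j
  · simpa using this
  · simpa [hxA j hj] using hg j
  · simp only [Pi.neg_apply, mul_neg, Finset.sum_neg_distrib]
    linarith [hxA' j hj]

/-- `1 - P` kills the constants, so it has a left null vector `v`. Entrywise `|v| ≤ |v| P`, and both
sides have the same total, so `|v|` is invariant; then normalise. -/
theorem exists_stationary [Nonempty ι] (hP : ∀ i j, 0 ≤ P i j) (hsum : ∀ i, ∑ j, P i j = 1) :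
    ∃ π ∈ stdSimplex ℝ ι, π ᵥ* P = π := by
  classical
  have hdet : (1 - P).det = 0 := by
    refine Matrix.exists_mulVec_eq_zero_iff.1 ⟨1, one_ne_zero, ?_⟩
    funext j
    rw [Matrix.sub_mulVec, Matrix.one_mulVec]
    simp [Matrix.mulVec, dotProduct, hsum]
  obtain ⟨v, hv0, hv⟩ := Matrix.exists_vecMul_eq_zero_iff.2 hdet
  rw [Matrix.vecMul_sub, Matrix.vecMul_one, sub_eq_zero] at hv
  have hle : ∀ k ∈ Finset.univ, |v k| ≤ ∑ j, |v j| * P j k := by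
    intro k _
    conv_lhs => rw [hv]
    refine (Finset.abs_sum_le_sum_abs _ _).trans (Finset.sum_le_sum fun j _ => ?_)
    rw [abs_mul, abs_of_nonneg (hP j k)]
  have htot : ∑ k, |v k| = ∑ k, ∑ j, |v j| * P j k := by
    rw [Finset.sum_comm]
    simp only [← Finset.mul_sum, hsum, mul_one]
  have heq := (Finset.sum_eq_sum_iff_of_le hle).1 htot
  have hpos : 0 < ∑ k, |v k| := by
    obtain ⟨k, hk⟩ := Function.ne_iff.1 hv0
    exact Finset.sum_pos' (fun k _ => abs_nonneg _) ⟨k, Finset.mem_univ k, abs_pos.2 hk⟩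
  refine ⟨fun k => |v k| / ∑ k, |v k|, ⟨fun k => by positivity, ?_⟩, ?_⟩
  · rw [← Finset.sum_div, div_self hpos.ne']
  · funext k
    simp only [Matrix.vecMul, dotProduct, div_mul_eq_mul_div]
    rw [← Finset.sum_div, ← heq k (Finset.mem_univ k)]

/-- Kac's formula: the stationary mass of `i` times the mean return time to `i` is `1`, where `b`
are the mean hitting times of `i`. -/
theorem stationary_mul_return_time {π b : ι → ℝ} (hπ : π ∈ stdSimplex ℝ ι) (hπP : π ᵥ* P = π)
    {i : ι} (hbi : b i = 0) (hb : ∀ j ≠ i, b j = 1 + ∑ k, P j k * b k) :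
    π i * (1 + ∑ k, P i k * b k) = 1 := by
  classical
  have h1 : ∑ j, π j * (1 + ∑ k, P j k * b k) = 1 + ∑ k, π k * b k := by
    simp only [mul_add, mul_one, Finset.sum_add_distrib, hπ.2, Finset.mul_sum]
    rw [Finset.sum_comm]
    congr 1
    refine Finset.sum_congr rfl fun k _ => ?_
    conv_rhs => rw [← hπP]
    simp only [Matrix.vecMul, dotProduct, Finset.sum_mul, mul_assoc]
  -- The terms off `i` agree on both sides by `hb`; only the return time at `i` survives.
  rw [← Finset.add_sum_erase _ _ (Finset.mem_univ i),
    ← Finset.add_sum_erase _ (fun k => π k * b k) (Finset.mem_univ i), hbi] at h1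
  have h2 : ∑ j ∈ Finset.univ.erase i, π j * (1 + ∑ k, P j k * b k) =
      ∑ j ∈ Finset.univ.erase i, π j * b j :=
    Finset.sum_congr rfl fun j hj => by rw [← hb j (Finset.ne_of_mem_erase hj)]
  linarith

end Stochastic

/-! ### First-step analysis and finite expectations -/

namespace WeightedDigraph

variable {n : ℕ} (G : WeightedDigraph n)

theorem degree_pos_of_stronglyConnected [Nontrivial (Fin n)] (hG : G.StronglyConnected)
    (i : Fin n) : 0 < G.degree i := by
  obtain ⟨j, hj⟩ := exists_ne i
  obtain h | ⟨k, hk, -⟩ := (hG i j).cases_head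
  · exact absurd h.symm hj
  · exact Finset.sum_pos' (fun l _ => G.weight_nonneg i l) ⟨k, Finset.mem_univ k, hk⟩

variable {G}

theorem transition_nonneg (hd : ∀ i, 0 < G.degree i) (i j : Fin n) : 0 ≤ G.transition i j :=
  div_nonneg (G.weight_nonneg i j) (hd i).le

theorem sum_transition (hd : ∀ i, 0 < G.degree i) (i : Fin n) : ∑ j, G.transition i j = 1 := by
  simp only [transition, Matrix.of_apply, ← Finset.sum_div]
  exact div_self (hd i).ne'

theorem StronglyConnected.transition (hG : G.StronglyConnected) (hd : ∀ i, 0 < G.degree i)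
    (i j : Fin n) : Relation.ReflTransGen (fun k l => 0 < G.transition k l) i j :=
  Relation.ReflTransGen.mono (fun k _ h => div_pos h (hd k)) i j (hG i j)

theorem stepPMF_apply (hd : ∀ i, 0 < G.degree i) (i j : Fin n) :
    G.stepPMF i j = ENNReal.ofReal (G.transition i j) := by
  rw [stepPMF, dif_pos (hd i), PMF.ofFintype_apply]

theorem isStationary_stationary [Nonempty (Fin n)] (hd : ∀ i, 0 < G.degree i) :
    G.IsStationary G.stationary :=
  Classical.epsilon_spec (p := G.IsStationary)
    (exists_stationary (transition_nonneg hd) (sum_transition hd))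

/-- First-step analysis for a functional of the walk. -/
theorem toReal_lintegral_walkLaw (hd : ∀ i, 0 < G.degree i) {i : Fin n} {c : ℝ≥0∞} (hc : c ≠ ∞)
    {f g : (ℕ → Fin n) → ℝ≥0∞} (hf : Measurable f) (hfg : ∀ ω, f (seqCons i ω) = c + g ω)
    (hg : ∀ k, ∫⁻ ω, g ω ∂G.walkLaw k ≠ ∞) :
    (∫⁻ ω, f ω ∂G.walkLaw i).toReal =
      c.toReal + ∑ k, G.transition i k * (∫⁻ ω, g ω ∂G.walkLaw k).toReal := by
  rw [lintegral_walkLaw _ _ hf]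
  simp only [hfg, lintegral_add_left measurable_const, lintegral_const, measure_univ, mul_one,
    stepPMF_apply hd]
  rw [ENNReal.toReal_sum fun k _ =>
    ENNReal.mul_ne_top ENNReal.ofReal_ne_top (ENNReal.add_ne_top.2 ⟨hc, hg k⟩)]
  calc _ = ∑ k, (G.transition i k * c.toReal +
        G.transition i k * (∫⁻ ω, g ω ∂G.walkLaw k).toReal) :=
        Finset.sum_congr rfl fun k _ => by
          rw [ENNReal.toReal_mul, ENNReal.toReal_ofReal (transition_nonneg hd i k),
            ENNReal.toReal_add hc (hg k), mul_add]
    _ = _ := by rw [Finset.sum_add_distrib, ← Finset.sum_mul, sum_transition hd, one_mul]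

/-- A random time that counts the steps of the walk outside a nonempty set `A` has finite
expectation from everywhere if it has finite expectation from `A`. -/
theorem lintegral_walkLaw_ne_top (hG : G.StronglyConnected) (hd : ∀ i, 0 < G.degree i)
    {A : Set (Fin n)} (hA : A.Nonempty) {T : (ℕ → Fin n) → ℝ≥0∞} (hT : Measurable T)
    (hTA : ∀ j ∈ A, ∫⁻ ω, T ω ∂G.walkLaw j ≠ ∞)
    (hstep : ∀ j ∉ A, ∀ ω, T (seqCons j ω) = 1 + T ω) (j : Fin n) :
    ∫⁻ ω, T ω ∂G.walkLaw j ≠ ∞ := by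
  obtain ⟨x, hx0, hxA, hx⟩ := exists_nonneg_solution (transition_nonneg hd) (sum_transition hd)
    (hG.transition hd) hA (g := fun j => (∫⁻ ω, T ω ∂G.walkLaw j).toReal)
    fun _ => ENNReal.toReal_nonneg
  -- Truncation allows induction on `m`, since a step off `A` turns level `m + 1` into `1` plus
  -- level `m`; monotone convergence then removes it.
  have hle : ∀ m : ℕ, ∀ j, ∫⁻ ω, min (T ω) m ∂G.walkLaw j ≤ ENNReal.ofReal (x j) := by
    intro m
    induction m with
    | zero => simp
    | succ m ih =>
      intro j
      by_cases hj : j ∈ A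
      · rw [hxA j hj, ENNReal.ofReal_toReal (hTA j hj)]
        exact lintegral_mono fun ω => min_le_left _ _
      · rw [lintegral_walkLaw _ _ (hT.min measurable_const), hx j hj, ENNReal.ofReal_add zero_le_one
          (Finset.sum_nonneg fun k _ => mul_nonneg (transition_nonneg hd j k) (hx0 k)),
          ENNReal.ofReal_sum_of_nonneg
            (fun k _ => mul_nonneg (transition_nonneg hd j k) (hx0 k)), ENNReal.ofReal_one,
          ← G.sum_ofReal_transition (hd j), ← Finset.sum_add_distrib]
        refine Finset.sum_le_sum fun k _ => ?_
        have : ∀ ω, min (T (seqCons j ω)) ((m + 1 : ℕ) : ℝ≥0∞) = 1 + min (T ω) m := fun ω => by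
          rw [hstep j hj, Nat.cast_succ, add_comm (m : ℝ≥0∞), min_add_add_left]
        simp only [this]
        rw [lintegral_add_left measurable_const, lintegral_const, measure_univ, mul_one, mul_add,
          mul_one, stepPMF_apply hd, ENNReal.ofReal_mul (transition_nonneg hd j k)]
        gcongr
        exact ih k
  have hsup : ∀ ω, T ω = ⨆ m : ℕ, min (T ω) m := fun ω => by
    rw [← inf_iSup_eq, ENNReal.iSup_natCast, inf_top_eq]
  rw [lintegral_congr hsup, lintegral_iSup (fun m => hT.min measurable_const)
    (fun a b hab ω => min_le_min_left _ (by exact_mod_cast hab))]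
  exact ne_top_of_le_ne_top ENNReal.ofReal_ne_top (iSup_le fun m => hle m j)

/-! ### Effect of one step on return times and hitting events -/

theorem measurable_returnTimeVia (i : Fin n) (X : Set (Fin n)) :
    Measurable (returnTimeVia i X) := by
  classical
  unfold returnTimeVia
  refine Measurable.iInf fun t => ?_
  simp only [iInf_eq_if]
  refine Measurable.ite ?_ measurable_const measurable_const
  have h : ∀ (s : ℕ) (Y : Set (Fin n)), MeasurableSet {ω : ℕ → Fin n | ω s ∈ Y} := fun s Y =>
    measurable_pi_apply s (Set.toFinite Y).measurableSet
  refine (h t {i}).inter ?_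
  have : {ω : ℕ → Fin n | ∃ s ≤ t, ω s ∈ X} = ⋃ s, ⋃ _ : s ≤ t, {ω | ω s ∈ X} := by
    ext; simp
  change MeasurableSet {ω : ℕ → Fin n | ∃ s ≤ t, ω s ∈ X}
  rw [this]
  exact MeasurableSet.iUnion fun s => MeasurableSet.iUnion fun _ => h s X

/-- `Y` is the visit still owed after the first step: `X` itself, or `Set.univ` once `X` has been
met, when only hitting `i` remains. `hij` rules out stopping at time `0`. -/
theorem returnTimeVia_seqCons {i j : Fin n} {X Y : Set (Fin n)} (hij : j = i → j ∉ X)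
    {ω : ℕ → Fin n} (hY : ∀ t, (∃ s ≤ t + 1, seqCons j ω s ∈ X) ↔ ∃ s ≤ t, ω s ∈ Y) :
    returnTimeVia i X (seqCons j ω) = 1 + returnTimeVia i Y ω := by
  classical
  unfold returnTimeVia
  rw [← inf_iInf_nat_succ, ENNReal.add_iInf]
  simp only [seqCons_succ, hY]
  have h0 : ¬ (j = i ∧ j ∈ X) := fun h => hij h.1 h.2
  simp only [iInf_eq_if, seqCons_zero, nonpos_iff_eq_zero, exists_eq_left, h0, if_false, top_inf_eq]
  refine iInf_congr fun t => ?_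
  split_ifs
  · push_cast; rw [add_comm]
  · simp

theorem returnTimeVia_seqCons_of_notMem {i j : Fin n} {X : Set (Fin n)} (hj : j ∉ X)
    (ω : ℕ → Fin n) : returnTimeVia i X (seqCons j ω) = 1 + returnTimeVia i X ω := by
  refine returnTimeVia_seqCons (fun _ => hj) fun t => ⟨?_, ?_⟩
  · rintro ⟨_ | s, hs, h⟩
    · exact absurd h hj
    · exact ⟨s, by omega, h⟩
  · rintro ⟨s, hs, h⟩
    exact ⟨s + 1, by omega, h⟩

theorem returnTimeVia_seqCons_of_mem {i j : Fin n} {X : Set (Fin n)} (hj : j ∈ X) (hij : j ≠ i)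
    (ω : ℕ → Fin n) : returnTimeVia i X (seqCons j ω) = 1 + returnTimeVia i Set.univ ω :=
  returnTimeVia_seqCons (fun h => absurd h hij) fun t =>
    ⟨fun _ => ⟨0, by omega, trivial⟩, fun _ => ⟨0, by omega, hj⟩⟩

theorem returnTimeVia_univ_seqCons_self (i : Fin n) (ω : ℕ → Fin n) :
    returnTimeVia i Set.univ (seqCons i ω) = 0 := by
  refine nonpos_iff_eq_zero.1 ((iInf₂_le 0 ⟨rfl, 0, le_rfl, trivial⟩).trans ?_)
  simp

/-- The trajectories that reach `X` without visiting `i` from time `a` on. -/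
def hitsBefore (a : ℕ) (i : Fin n) (X : Set (Fin n)) : Set (ℕ → Fin n) :=
  {ω | ∃ t, ω t ∈ X ∧ ∀ s, a ≤ s → s ≤ t → ω s ≠ i}

theorem measurableSet_hitsBefore (a : ℕ) (i : Fin n) (X : Set (Fin n)) :
    MeasurableSet (hitsBefore a i X) := by
  have h : ∀ (s : ℕ) (Y : Set (Fin n)), MeasurableSet {ω : ℕ → Fin n | ω s ∈ Y} := fun s Y =>
    measurable_pi_apply s (Set.toFinite Y).measurableSet
  have : hitsBefore a i X =
      ⋃ t, {ω | ω t ∈ X} ∩ ⋂ s, ⋂ _ : a ≤ s, ⋂ _ : s ≤ t, {ω | ω s ∈ ({i}ᶜ : Set (Fin n))} := by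
    ext; simp [hitsBefore]
  rw [this]
  exact MeasurableSet.iUnion fun t => (h t X).inter <| MeasurableSet.iInter fun s =>
    MeasurableSet.iInter fun _ => MeasurableSet.iInter fun _ => h s _

/-- Truncated subtraction serves both uses: `a = 1` (escape) becomes `0` after a step, and `a = 0`
stays `0`. -/
theorem seqCons_mem_hitsBefore {a : ℕ} {i j : Fin n} {X : Set (Fin n)} (hj : j ∉ X)
    (ha : a = 0 → j ≠ i) (ω : ℕ → Fin n) :
    seqCons j ω ∈ hitsBefore a i X ↔ ω ∈ hitsBefore (a - 1) i X := by
  constructor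
  · rintro ⟨_ | t, ht, h⟩
    · exact absurd ht hj
    · exact ⟨t, ht, fun s h1 h2 => h (s + 1) (by omega) (by omega)⟩
  · rintro ⟨t, ht, h⟩
    refine ⟨t + 1, ht, ?_⟩
    rintro (_ | s) h1 h2
    · exact ha (by omega)
    · exact h s (by omega) (by omega)

/-! ### The product identity for escape probability and commute time -/

open Classical in
theorem commuteTime_mul_escapeProb (hG : G.StronglyConnected) (hd : ∀ i, 0 < G.degree i)
    {i : Fin n} {X : Set (Fin n)} (hX : X.Nonempty) (hi : i ∉ X) :
    G.commuteTime i X ≠ ∞ ∧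
      G.stationary i * G.escapeProb i X * (G.commuteTime i X).toReal = 1 := by
  have : Nonempty (Fin n) := ⟨i⟩
  have hXi : ∀ j ∈ X, j ≠ i := fun j hj h => hi (h ▸ hj)
  have hb_zero : ∫⁻ ω, returnTimeVia i Set.univ ω ∂G.walkLaw i = 0 := by
    simp [lintegral_walkLaw _ _ (measurable_returnTimeVia i _), returnTimeVia_univ_seqCons_self]
  have hb_top : ∀ j, ∫⁻ ω, returnTimeVia i Set.univ ω ∂G.walkLaw j ≠ ∞ :=
    lintegral_walkLaw_ne_top hG hd (Set.singleton_nonempty i) (measurable_returnTimeVia i _)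
      (by simp [hb_zero]) fun j hj => returnTimeVia_seqCons_of_mem (Set.mem_univ j) hj
  -- On `X` only the hitting of `i` remains, so `hb_top` bounds the boundary values.
  have ha_top : ∀ j, ∫⁻ ω, returnTimeVia i X ω ∂G.walkLaw j ≠ ∞ := by
    refine lintegral_walkLaw_ne_top hG hd hX (measurable_returnTimeVia i _) (fun j hj => ?_)
      fun j hj => returnTimeVia_seqCons_of_notMem hj
    rw [lintegral_walkLaw _ _ (measurable_returnTimeVia i _)]
    simp only [returnTimeVia_seqCons_of_mem hj (hXi j hj), lintegral_add_left measurable_const,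
      lintegral_const, measure_univ, mul_one]
    exact ENNReal.sum_ne_top.2 fun k _ => ENNReal.mul_ne_top (PMF.apply_ne_top _ _)
      (ENNReal.add_ne_top.2 ⟨ENNReal.one_ne_top, hb_top k⟩)
  let E (m : ℕ) (ω : ℕ → Fin n) : ℝ≥0∞ := (hitsBefore m i X).indicator 1 ω
  have hE : ∀ m, Measurable (E m) := fun m =>
    measurable_one.indicator (measurableSet_hitsBefore m i X)
  have hE_int : ∀ m j, ∫⁻ ω, E m ω ∂G.walkLaw j = G.walkLaw j (hitsBefore m i X) := fun m j =>
    lintegral_indicator_one (measurableSet_hitsBefore m i X)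
  have hE_top : ∀ j, ∫⁻ ω, E 0 ω ∂G.walkLaw j ≠ ∞ := fun j => by
    rw [hE_int]; exact measure_ne_top _ _
  have hE_step : ∀ m j, j ∉ X → (m = 0 → j ≠ i) → ∀ ω, E m (seqCons j ω) = 0 + E (m - 1) ω := by
    intro m j hj hm ω
    simp only [E, Set.indicator_apply, seqCons_mem_hitsBefore hj hm, zero_add, Pi.one_apply]
  set a : Fin n → ℝ := fun j => (∫⁻ ω, returnTimeVia i X ω ∂G.walkLaw j).toReal
  set b : Fin n → ℝ := fun j => (∫⁻ ω, returnTimeVia i Set.univ ω ∂G.walkLaw j).toReal with hb_def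
  set p : Fin n → ℝ := fun j => (∫⁻ ω, E 0 ω ∂G.walkLaw j).toReal
  have hbi : b i = 0 := by simp [hb_def, hb_zero]
  have hb : ∀ j ≠ i, b j = 1 + ∑ k, G.transition j k * b k := fun j hj =>
    toReal_lintegral_walkLaw hd ENNReal.one_ne_top (measurable_returnTimeVia i _)
      (returnTimeVia_seqCons_of_mem (Set.mem_univ j) hj) hb_top
  have haX : ∀ j ∈ X, a j = b j := fun j hj => by
    rw [hb j (hXi j hj)]
    exact toReal_lintegral_walkLaw hd ENNReal.one_ne_top (measurable_returnTimeVia i _)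
      (returnTimeVia_seqCons_of_mem hj (hXi j hj)) hb_top
  have ha : ∀ j ∉ X, a j = 1 + ∑ k, G.transition j k * a k := fun j hj =>
    toReal_lintegral_walkLaw hd ENNReal.one_ne_top (measurable_returnTimeVia i _)
      (returnTimeVia_seqCons_of_notMem hj) ha_top
  have hpX : ∀ j ∈ X, p j = 1 := by
    intro j hj
    -- The sum matches `c + g ω` with `g = 0` in `toReal_lintegral_walkLaw`.
    have h : ∀ ω, E 0 (seqCons j ω) = 1 + 0 := fun ω => by
      have : seqCons j ω ∈ hitsBefore 0 i X :=
        ⟨0, hj, fun s _ hs => by obtain rfl : s = 0 := by omega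
                                 exact hXi j hj⟩
      simp [E, this]
    simpa using toReal_lintegral_walkLaw hd ENNReal.one_ne_top (hE 0) h (by simp)
  have hpi : p i = 0 := by
    have h : ∀ ω, E 0 (seqCons i ω) = 0 + 0 := fun ω => by
      have : seqCons i ω ∉ hitsBefore 0 i X := fun ⟨t, _, h⟩ => h 0 le_rfl (Nat.zero_le t) rfl
      simp [E, this]
    simpa using toReal_lintegral_walkLaw hd ENNReal.zero_ne_top (hE 0) h (by simp)
  have hp : ∀ j ∉ X, j ≠ i → p j = ∑ k, G.transition j k * p k := fun j hj hji => by
    simpa using toReal_lintegral_walkLaw hd ENNReal.zero_ne_top (hE 0)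
      (hE_step 0 j hj fun _ => hji) hE_top
  have hes : G.escapeProb i X = ∑ k, G.transition i k * p k := by
    have := toReal_lintegral_walkLaw hd ENNReal.zero_ne_top (hE 1)
      (hE_step 1 i hi (by simp)) hE_top
    rw [hE_int, ENNReal.toReal_zero, zero_add] at this
    exact this
  have hsum := sum_transition hd
  have hle := fun (y : Fin n → ℝ) => subharmonic_nonpos (transition_nonneg hd) hsum
    (hG.transition hd) (x := y) (A := insert i X) (Set.insert_nonempty i X)
  -- This defect vanishes on `insert i X` and is harmonic elsewhere, so the maximum principle for it
  -- and its negative makes it zero.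
  have hδA : ∀ j ∈ insert i X, a j - b j - (1 - p j) * a i = 0 := by
    rintro j (rfl | hj)
    · rw [hbi, hpi]; ring
    · rw [haX j hj, hpX j hj]; ring
  have hlin : ∀ j, ∑ k, G.transition j k * (a k - b k - (1 - p k) * a i) =
      ∑ k, G.transition j k * a k - ∑ k, G.transition j k * b k -
        (1 - ∑ k, G.transition j k * p k) * a i := by
    intro j
    have h : 1 - ∑ k, G.transition j k * p k = ∑ k, G.transition j k * (1 - p k) := by
      simp only [mul_sub, mul_one, Finset.sum_sub_distrib, hsum]
    simp only [h, ← Finset.sum_sub_distrib, Finset.sum_mul]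
    exact Finset.sum_congr rfl fun k _ => by ring
  have hδ : ∀ j ∉ insert i X, a j - b j - (1 - p j) * a i =
      ∑ k, G.transition j k * (a k - b k - (1 - p k) * a i) := by
    intro j hj
    obtain ⟨hji, hjX⟩ := not_or.1 hj
    rw [hlin, ha j hjX, hb j hji, hp j hjX hji]
    ring
  have hzero : ∀ j, a j - b j - (1 - p j) * a i = 0 := by
    intro j
    refine le_antisymm (hle _ (fun j hj => (hδA j hj).le) (fun j hj => (hδ j hj).le) j) ?_
    have := hle (fun j => -(a j - b j - (1 - p j) * a i)) (fun j hj => by rw [hδA j hj, neg_zero])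
      (fun j hj => by
        simp only [mul_neg, Finset.sum_neg_distrib]
        exact (neg_le_neg_iff.2 (hδ j hj).ge)) j
    linarith
  -- The equation for `p` fails at `i`: there the average of `p` is the escape probability, while `p
  -- i = 0`.
  have hai := hlin i
  simp only [hzero, mul_zero, Finset.sum_const_zero, ← hes] at hai
  obtain ⟨hπ, hπP⟩ := isStationary_stationary hd
  have kac := stationary_mul_return_time hπ hπP hbi hb
  refine ⟨ha_top i, ?_⟩
  change G.stationary i * G.escapeProb i X * a i = 1
  rw [← kac, mul_assoc]
  congr 1
  linarith [ha i hi]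

end WeightedDigraph

theorem mainTheorem6 {n : ℕ} (G : WeightedDigraph n) (hG : G.StronglyConnected)
    (i : Fin n) (X : Set (Fin n)) (hX : X.Nonempty) (hi : i ∉ X) :
    G.volume * G.stationary i * G.escapeProb i X ≠ 0 ∧
      G.commuteTime i X ≠ ∞ ∧
      G.resistance i X = 1 / G.volume * (G.commuteTime i X).toReal := by
  obtain ⟨x, hx⟩ := hX
  -- A second vertex forces an arc out of every vertex, so all degrees are positive.
  have : Nontrivial (Fin n) := ⟨i, x, fun h => hi (h ▸ hx)⟩
  have hd := G.degree_pos_of_stronglyConnected hG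
  obtain ⟨htop, h⟩ := WeightedDigraph.commuteTime_mul_escapeProb hG hd ⟨x, hx⟩ hi
  have hvol : G.volume ≠ 0 :=
    (Finset.sum_pos (fun j _ => hd j) ⟨i, Finset.mem_univ i⟩).ne'
  have hne : G.stationary i * G.escapeProb i X ≠ 0 := left_ne_zero_of_mul_eq_one h
  refine ⟨by rw [mul_assoc]; exact mul_ne_zero hvol hne, htop, ?_⟩
  rw [WeightedDigraph.resistance, mul_assoc, one_div, mul_inv, one_div,
    eq_inv_of_mul_eq_one_right h]
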